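/- Conventions. A partially ordered group (po-group) is a group $G$ with a partial order such that $a\le b$ implies $sat\le sbt$ for all $a,b,s,t\in G$; its positive cone is $G^+=\{a\in G: a\ge e\}$. An $\ell$-group is a po-group whose order is a lattice order; an $\ell$-homomorphism is a group homomorphism that is also a lattice homomorphism. An $\ell$-group is representable if it is a subdirect product of totally ordered groups, and Abelian if its group is Abelian. A right pre-order on a po-group $G$ is identified with its cone: a proper submonoid $C\subsetneq G$ with $G=C\cup C^{-1}$ and $G^+\subseteq C$; it encodes the relation $a\preceq_C b\iff ba^{-1}\in C$. Let $\Omega_C$ be the chain obtained as the quotient of $G$ by the equivalence relation "$a\preceq_C b$ and $b\preceq_C a$", and let $\mathrm{Aut}(\Omega_C)$ be the $\ell$-group of its order-preserving bijections, with $f\cdot g$ standing for "$g$ after $f$" and pointwise lattice operations. Let $H_C$ be the $\ell$-subgroup of $\mathrm{Aut}(\Omega_C)$ generated by the maps $[b]\mapsto[ba]$, $a\in G$. For a variety $\mathsf V$ of $\ell$-groups, let $\mathcal P_{\mathsf V}(G)$ be the set of right pre-orders $C$ on $G$ with $H_C\in\mathsf V$, with the smallest topology containing all the sets $\{C : a\in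 C,\ a^{-1}\notin C\}$, $a\in G$. The minimal layer of $\mathcal P_{\mathsf V}(G)$ is the subspace of its inclusion-minimal elements. A right order on $G$ is a right pre-order $C$ with $C\cap C^{-1}=\{e\}$; an order on $G$ is a right order that is closed under conjugation. The sets of right orders and of orders on $G$ carry the subspace topology from the space of all right pre-orders on $G$ (equivalently, the topology with subbase the sets $\{C: a\in C\}$ and $\{C: a\notin C\}$, $a\in G$). Let $\eta\colon G\to F_{\mathsf V}(G)$ be the universal order-preserving homomorphism from $G$ to an $\ell$-group in $\mathsf V$: every order-preserving homomorphism $p\colon G\to H$ with $H\in\mathsf V$ factors as $p=h\circ\eta$ for exactly one $\ell$-homomorphism $h\colon F_{\mathsf V}(G)\to H$. Let $\eta[G]$ be the image of $G$, partially ordered by the restriction of the order of $F_{\mathsf V}(G)$. Theorem. Let $G$ be any partially ordered group. (1) If $\mathsf V$ is the variety of all $\ell$-groups, the minimal layer of $\mathcal P_{\mathsf V}(G)$ is homeomorphic to the space of right orders on $\eta[G]$. (2) If $\mathsf V$ is the variety of representable $\ell$-groups, the minimal layer of $\mathcal P_{\mathsf V}(G)$ is homeomorphic to the space of orders on $\eta[G]$.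 (3) If $\mathsf V$ is the variety of Abelian $\ell$-groups, the minimal layer of $\mathcal P_{\mathsf V}(G)$ is homeomorphic to the space of orders on $\eta[G]$. -/

import Mathlib

universe u

namespace RightPreorders

/-! ### Lattice-ordered groups

A partially ordered group is a group with a partial order that is compatible with multiplication
on both sides: `[Group G] [PartialOrder G] [MulLeftMono G] [MulRightMono G]`.  An ℓ-group is a
partially ordered group whose order is a lattice order. -/

/-- A class of ℓ-groups. -/
abbrev LGroupClass : Type (u + 1) :=
  ∀ (H : Type u) [Group H] [Lattice H] [MulLeftMono H] [MulRightMono H], Prop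

/-- A group homomorphism between ℓ-groups that preserves binary suprema and infima. -/
def IsLHom {H K : Type*} [Group H] [Lattice H] [Group K] [Lattice K] (f : H →* K) : Prop :=
  (∀ a b, f (a ⊔ b) = f a ⊔ f b) ∧ ∀ a b, f (a ⊓ b) = f a ⊓ f b

/-- The variety of all ℓ-groups. -/
def AllLGroups : LGroupClass.{u} := fun _ _ _ _ _ => True

/-- The variety of representable ℓ-groups: subdirect products of totally ordered groups, that is,
ℓ-groups with a jointly injective family of surjective ℓ-homomorphisms onto totally ordered
groups. -/
def RepresentableLGroups : LGroupClass.{u} := fun H _ _ _ _ =>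
  ∃ (ι : Type u) (K : ι → Type u) (_ : ∀ i, Group (K i)) (_ : ∀ i, LinearOrder (K i))
    (_ : ∀ i, MulLeftMono (K i)) (_ : ∀ i, MulRightMono (K i)) (f : ∀ i, H →* K i),
    (∀ i, IsLHom (f i)) ∧ (∀ i, Function.Surjective (f i)) ∧
      ∀ a b : H, (∀ i, f i a = f i b) → a = b

/-- The variety of Abelian ℓ-groups. -/
def AbelianLGroups : LGroupClass.{u} := fun H _ _ _ _ => ∀ a b : H, a * b = b * a

/-- A sublattice subgroup of an ℓ-group. -/
structure LSubgroup (H : Type*) [Group H] [Lattice H] extends Subgroup H where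
  sup_mem' : ∀ ⦃a b : H⦄, a ∈ carrier → b ∈ carrier → a ⊔ b ∈ carrier
  inf_mem' : ∀ ⦃a b : H⦄, a ∈ carrier → b ∈ carrier → a ⊓ b ∈ carrier

/-- The ℓ-subgroup generated by a set: the intersection of all ℓ-subgroups containing it. -/
def LSubgroup.closure {H : Type*} [Group H] [Lattice H] (s : Set H) : LSubgroup H where
  carrier := {x | ∀ K : LSubgroup H, s ⊆ K.carrier → x ∈ K.carrier}
  one_mem' := fun K _ => K.one_mem'
  mul_mem' := fun ha hb K hK => K.mul_mem' (ha K hK) (hb K hK)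
  inv_mem' := fun ha K hK => K.inv_mem' (ha K hK)
  sup_mem' := fun _ _ ha hb K hK => K.sup_mem' (ha K hK) (hb K hK)
  inf_mem' := fun _ _ ha hb K hK => K.inf_mem' (ha K hK) (hb K hK)

instance {H : Type*} [Group H] [Lattice H] (K : LSubgroup H) : Lattice K.toSubgroup :=
  Subtype.lattice (fun {_ _} ha hb => K.sup_mem' ha hb) (fun {_ _} ha hb => K.inf_mem' ha hb)

instance {H : Type*} [Group H] [Lattice H] [MulLeftMono H] (K : LSubgroup H) :
    MulLeftMono K.toSubgroup :=
  ⟨fun a _ _ h => mul_le_mul_right (α := H) h (a : H)⟩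

instance {H : Type*} [Group H] [Lattice H] [MulRightMono H] (K : LSubgroup H) :
    MulRightMono K.toSubgroup :=
  ⟨fun a _ _ h => mul_le_mul_left (α := H) h (a : H)⟩

/-! ### The ℓ-group of automorphisms of a chain -/

/-- The order-preserving bijections of a chain, with the product `f * g` standing for
`g` after `f`, and with the pointwise order. -/
def ChainAut (Ω : Type*) [LinearOrder Ω] : Type _ := Ω ≃o Ω

namespace ChainAut

variable {Ω : Type*} [LinearOrder Ω]

instance : FunLike (ChainAut Ω) Ω Ω where
  coe f := ((show Ω ≃o Ω from f) : Ω → Ω)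
  coe_injective := fun _ _ h => DFunLike.coe_injective (F := Ω ≃o Ω) h

@[ext] theorem ext {f g : ChainAut Ω} (h : ∀ x, f x = g x) : f = g := DFunLike.ext f g h

instance : Group (ChainAut Ω) where
  mul f g := OrderIso.trans (show Ω ≃o Ω from f) (show Ω ≃o Ω from g)
  one := OrderIso.refl Ω
  inv f := OrderIso.symm (show Ω ≃o Ω from f)
  mul_assoc _ _ _ := rfl
  one_mul _ := rfl
  mul_one _ := rfl
  inv_mul_cancel f := OrderIso.symm_trans_self (show Ω ≃o Ω from f)

theorem mul_apply (f g : ChainAut Ω) (x : Ω) : (f * g) x = g (f x) := rfl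

theorem apply_le_apply (f : ChainAut Ω) {x y : Ω} : f x ≤ f y ↔ x ≤ y :=
  OrderIso.le_iff_le (show Ω ≃o Ω from f)

theorem apply_lt_apply (f : ChainAut Ω) {x y : Ω} : f x < f y ↔ x < y :=
  OrderIso.lt_iff_lt (show Ω ≃o Ω from f)

theorem inv_apply_apply (f : ChainAut Ω) (x : Ω) : f⁻¹ (f x) = x :=
  OrderIso.symm_apply_apply (show Ω ≃o Ω from f) x

theorem apply_inv_apply (f : ChainAut Ω) (x : Ω) : f (f⁻¹ x) = x :=
  OrderIso.apply_symm_apply (show Ω ≃o Ω from f) x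

theorem surj_sup (f g : ChainAut Ω) (y : Ω) : ∃ x, f x ⊔ g x = y := by
  rcases le_total (f⁻¹ y) (g⁻¹ y) with h | h
  · refine ⟨f⁻¹ y, ?_⟩
    rw [apply_inv_apply, sup_eq_left]
    calc g (f⁻¹ y) ≤ g (g⁻¹ y) := (apply_le_apply g).2 h
      _ = y := apply_inv_apply g y
  · refine ⟨g⁻¹ y, ?_⟩
    rw [apply_inv_apply, sup_eq_right]
    calc f (g⁻¹ y) ≤ f (f⁻¹ y) := (apply_le_apply f).2 h
      _ = y := apply_inv_apply f y

theorem surj_inf (f g : ChainAut Ω) (y : Ω) : ∃ x, f x ⊓ g x = y := by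
  rcases le_total (f⁻¹ y) (g⁻¹ y) with h | h
  · refine ⟨g⁻¹ y, ?_⟩
    rw [apply_inv_apply, inf_eq_right]
    calc y = f (f⁻¹ y) := (apply_inv_apply f y).symm
      _ ≤ f (g⁻¹ y) := (apply_le_apply f).2 h
  · refine ⟨f⁻¹ y, ?_⟩
    rw [apply_inv_apply, inf_eq_left]
    calc y = g (g⁻¹ y) := (apply_inv_apply g y).symm
      _ ≤ g (f⁻¹ y) := (apply_le_apply g).2 h

/-- The automorphism with a given strictly monotone surjective underlying map. -/
noncomputable def ofStrictMono (φ : Ω → Ω) (h : StrictMono φ) (hs : Function.Surjective φ) :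
    ChainAut Ω :=
  StrictMono.orderIsoOfSurjective φ h hs

theorem ofStrictMono_apply (φ : Ω → Ω) (h : StrictMono φ) (hs : Function.Surjective φ) (x : Ω) :
    ofStrictMono φ h hs x = φ x := rfl

instance : PartialOrder (ChainAut Ω) := PartialOrder.lift (fun f => (f : Ω → Ω)) DFunLike.coe_injective

theorem le_def {f g : ChainAut Ω} : f ≤ g ↔ ∀ x, f x ≤ g x := Iff.rfl

/-- The lattice operations are pointwise. -/
noncomputable instance : Lattice (ChainAut Ω) where
  sup f g := ofStrictMono (fun x => f x ⊔ g x)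
    (fun _ _ h => max_lt_max ((apply_lt_apply f).2 h) ((apply_lt_apply g).2 h)) (surj_sup f g)
  inf f g := ofStrictMono (fun x => f x ⊓ g x)
    (fun _ _ h => min_lt_min ((apply_lt_apply f).2 h) ((apply_lt_apply g).2 h)) (surj_inf f g)
  le_sup_left f g := fun x => (le_sup_left : f x ≤ f x ⊔ g x)
  le_sup_right f g := fun x => (le_sup_right : g x ≤ f x ⊔ g x)
  sup_le _ _ _ h₁ h₂ := fun x => sup_le (h₁ x) (h₂ x)
  inf_le_left f g := fun x => (inf_le_left : f x ⊓ g x ≤ f x)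
  inf_le_right f g := fun x => (inf_le_right : f x ⊓ g x ≤ g x)
  le_inf _ _ _ h₁ h₂ := fun x => le_inf (h₁ x) (h₂ x)

instance : MulLeftMono (ChainAut Ω) := ⟨fun f _ _ h x => h (f x)⟩

instance : MulRightMono (ChainAut Ω) := ⟨fun f _ _ h x => (apply_le_apply f).2 (h x)⟩

end ChainAut

/-! ### Right pre-orders, as pre-cones -/

section PreCones

/-- A pre-cone of a partially ordered group `G`: a proper submonoid `C` with `G = C ∪ C⁻¹` that
contains the positive cone of `G`.  It encodes the right pre-order `a ≼ b ↔ b * a⁻¹ ∈ C`. -/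
structure PreCone (G : Type u) [Group G] [PartialOrder G] extends Submonoid G where
  proper' : carrier ≠ Set.univ
  total' : ∀ a : G, a ∈ carrier ∨ a⁻¹ ∈ carrier
  pos_mem' : ∀ a : G, 1 ≤ a → a ∈ carrier

variable {G : Type u} [Group G] [PartialOrder G]

instance : SetLike (PreCone G) G where
  coe C := C.carrier
  coe_injective := by
    rintro ⟨C, _, _, _⟩ ⟨D, _, _, _⟩ h
    obtain rfl : C = D := SetLike.coe_injective h
    rfl

/-- Pre-cones are ordered by inclusion. -/
instance : PartialOrder (PreCone G) := PartialOrder.lift (fun C => (C : Set G)) SetLike.coe_injective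

namespace PreCone

theorem one_mem (C : PreCone G) : (1 : G) ∈ C := C.one_mem'

theorem mul_mem (C : PreCone G) {a b : G} (ha : a ∈ C) (hb : b ∈ C) : a * b ∈ C :=
  C.mul_mem' ha hb

/-- The right pre-order of a pre-cone. -/
def Rel (C : PreCone G) (a b : G) : Prop := b * a⁻¹ ∈ C

theorem rel_refl (C : PreCone G) (a : G) : C.Rel a a := by
  simpa [Rel] using C.one_mem

theorem rel_trans (C : PreCone G) {a b c : G} (h₁ : C.Rel a b) (h₂ : C.Rel b c) : C.Rel a c := by
  have h := C.mul_mem h₂ h₁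
  simpa [Rel, mul_assoc] using h

theorem rel_total (C : PreCone G) (a b : G) : C.Rel a b ∨ C.Rel b a := by
  have h : b * a⁻¹ ∈ C ∨ (b * a⁻¹)⁻¹ ∈ C := C.total' (b * a⁻¹)
  simpa [Rel] using h

theorem rel_mul_right_iff (C : PreCone G) (a b t : G) : C.Rel (a * t) (b * t) ↔ C.Rel a b := by
  simp [Rel, mul_assoc]

/-- The equivalence relation `a ≼ b ∧ b ≼ a`. -/
def setoid (C : PreCone G) : Setoid G where
  r a b := C.Rel a b ∧ C.Rel b a
  iseqv :=
    ⟨fun a => ⟨C.rel_refl a, C.rel_refl a⟩, fun h => ⟨h.2, h.1⟩,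
      fun h₁ h₂ => ⟨C.rel_trans h₁.1 h₂.1, C.rel_trans h₂.2 h₁.2⟩⟩

/-- The quotient `Ω_C` of `G` by the equivalence relation of the right pre-order. -/
def Chain (C : PreCone G) : Type u := Quotient C.setoid

/-- The class of `a` in `Ω_C`. -/
def cls (C : PreCone G) (a : G) : C.Chain := Quotient.mk C.setoid a

/-- The total order of `Ω_C`: `[a] ≤ [b] ↔ a ≼ b`. -/
noncomputable instance (C : PreCone G) : LinearOrder C.Chain where
  le := Quotient.lift₂ (s₁ := C.setoid) (s₂ := C.setoid) C.Rel (fun _ _ _ _ h₁ h₂ => propext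
    ⟨fun h => C.rel_trans (C.rel_trans h₁.2 h) h₂.1,
      fun h => C.rel_trans (C.rel_trans h₁.1 h) h₂.2⟩)
  le_refl := by rintro ⟨a⟩; exact C.rel_refl a
  le_trans := by rintro ⟨a⟩ ⟨b⟩ ⟨c⟩ h₁ h₂; exact C.rel_trans h₁ h₂
  le_antisymm := by rintro ⟨a⟩ ⟨b⟩ h₁ h₂; exact Quotient.sound ⟨h₁, h₂⟩
  le_total := by rintro ⟨a⟩ ⟨b⟩; exact C.rel_total a b
  toDecidableLE := Classical.decRel _

theorem cls_le_cls (C : PreCone G) (a b : G) : C.cls a ≤ C.cls b ↔ b * a⁻¹ ∈ C := Iff.rfl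

/-- Right multiplication by `a` on `Ω_C`, that is, `[b] ↦ [b * a]`. -/
def mulRight (C : PreCone G) (a : G) : C.Chain → C.Chain :=
  Quotient.map (sa := C.setoid) (sb := C.setoid) (fun b => b * a)
    (fun b c h => ⟨(C.rel_mul_right_iff b c a).2 h.1, (C.rel_mul_right_iff c b a).2 h.2⟩)

/-- The positive homomorphism `ρ_C : G → Aut Ω_C` with `ρ_C(a)([b]) = [b * a]`. -/
def rho (C : PreCone G) : G →* ChainAut C.Chain where
  toFun a := show C.Chain ≃o C.Chain from
    { toFun := C.mulRight a
      invFun := C.mulRight a⁻¹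
      left_inv := by
        rintro ⟨b⟩
        exact congrArg C.cls (mul_inv_cancel_right b a)
      right_inv := by
        rintro ⟨b⟩
        exact congrArg C.cls (inv_mul_cancel_right b a)
      map_rel_iff' := by
        rintro ⟨b⟩ ⟨c⟩
        exact C.rel_mul_right_iff b c a }
  map_one' := by
    refine ChainAut.ext ?_
    rintro ⟨b⟩
    exact congrArg C.cls (mul_one b)
  map_mul' a a' := by
    refine ChainAut.ext ?_
    rintro ⟨b⟩
    exact congrArg C.cls (mul_assoc b a a').symm

theorem rho_cls (C : PreCone G) (a b : G) : C.rho a (C.cls b) = C.cls (b * a) := rfl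

/-- The ℓ-group `H_C`: the ℓ-subgroup of `Aut Ω_C` generated by the image of `ρ_C`. -/
abbrev LGroupOf (C : PreCone G) : Type u :=
  (LSubgroup.closure (Set.range C.rho)).toSubgroup

/-- The right pre-order of `C` is antisymmetric, that is, `C ∩ C⁻¹ = {1}`. -/
def IsRightOrder (C : PreCone G) : Prop := ∀ a, a ∈ C → a⁻¹ ∈ C → a = 1

/-- `C` is closed under conjugation, that is, its right pre-order is also left invariant. -/
def IsNormal (C : PreCone G) : Prop := ∀ a ∈ C, ∀ g : G, g * a * g⁻¹ ∈ C

/-- The smallest topology in which all the sets `{C | a ∈ C ∧ a⁻¹ ∉ C}` are open. -/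
instance : TopologicalSpace (PreCone G) :=
  TopologicalSpace.generateFrom (Set.range fun a : G => {C : PreCone G | a ∈ C ∧ a⁻¹ ∉ C})

end PreCone

variable (V : LGroupClass.{u}) (G)

/-- The right pre-orders `C` on `G` such that `H_C` lies in `V`.  As a subspace of `PreCone G` it
carries the smallest topology containing all the sets `{C | a ∈ C ∧ a⁻¹ ∉ C}`. -/
def VPreCones : Set (PreCone G) := {C | V C.LGroupOf}

/-- The minimal layer: the space of inclusion-minimal right pre-orders of the class `V`. -/
def MinimalLayer : Set (PreCone G) := {C | Minimal (· ∈ VPreCones G V) C}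

/-- The space of right orders on `G`. -/
def RightOrders : Set (PreCone G) := {C | C.IsRightOrder}

/-- The space of orders on `G`: the right orders that are also left invariant. -/
def BiOrders : Set (PreCone G) := {C | C.IsRightOrder ∧ C.IsNormal}

end PreCones

/-! ### The free ℓ-group in a class over a partially ordered group -/

/-- ℓ-group terms with variables from `G`. -/
inductive LTerm (G : Type u) : Type u
  | of : G → LTerm G
  | one : LTerm G
  | mul : LTerm G → LTerm G → LTerm G
  | inv : LTerm G → LTerm G
  | sup : LTerm G → LTerm G → LTerm G
  | inf : LTerm G → LTerm G → LTerm G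

/-- The value of a term under an assignment of the variables. -/
def LTerm.eval {G : Type u} {H : Type*} [Group H] [Lattice H] (p : G → H) : LTerm G → H
  | .of g => p g
  | .one => 1
  | .mul s t => s.eval p * t.eval p
  | .inv s => (s.eval p)⁻¹
  | .sup s t => s.eval p ⊔ t.eval p
  | .inf s t => s.eval p ⊓ t.eval p

section Free

variable (V : LGroupClass.{u}) (G : Type u) [Group G] [PartialOrder G]

/-- The inequality `s ≤ t` holds under every positive homomorphism from `G` to an ℓ-group
in `V`. -/
def LTerm.Le (s t : LTerm G) : Prop :=
  ∀ (H : Type u) [Group H] [Lattice H] [MulLeftMono H] [MulRightMono H], V H →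
    ∀ p : G →* H, Monotone p → s.eval p ≤ t.eval p

/-- Two terms are identified when they have the same value under every positive homomorphism from
`G` to an ℓ-group in `V`. -/
def LTerm.setoid : Setoid (LTerm G) where
  r s t := LTerm.Le V G s t ∧ LTerm.Le V G t s
  iseqv :=
    ⟨fun _ => ⟨fun _ _ _ _ _ _ _ _ => le_rfl, fun _ _ _ _ _ _ _ _ => le_rfl⟩,
      fun h => ⟨h.2, h.1⟩,
      fun h₁ h₂ => ⟨fun H _ _ _ _ hH p hp => (h₁.1 H hH p hp).trans (h₂.1 H hH p hp),
        fun H _ _ _ _ hH p hp => (h₂.2 H hH p hp).trans (h₁.2 H hH p hp)⟩⟩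

/-- The ℓ-group free over `G` in `V`; see `FreeLGroup.universal` for its universal property. -/
def FreeLGroup : Type u := Quotient (LTerm.setoid V G)

namespace FreeLGroup

variable {V G}

/-- The class of a term. -/
def mk (t : LTerm G) : FreeLGroup V G := Quotient.mk (LTerm.setoid V G) t

theorem sound {s t : LTerm G}
    (h : ∀ (H : Type u) [Group H] [Lattice H] [MulLeftMono H] [MulRightMono H], V H →
      ∀ p : G →* H, Monotone p → s.eval p = t.eval p) :
    (mk s : FreeLGroup V G) = mk t :=
  Quotient.sound ⟨fun H _ _ _ _ hH p hp => (h H hH p hp).le,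
    fun H _ _ _ _ hH p hp => (h H hH p hp).ge⟩

theorem eval_eq {s t : LTerm G} (h : LTerm.setoid V G s t) {H : Type u} [Group H] [Lattice H]
    [MulLeftMono H] [MulRightMono H] (hH : V H) (p : G →* H) (hp : Monotone p) :
    s.eval p = t.eval p :=
  le_antisymm (h.1 H hH p hp) (h.2 H hH p hp)

theorem rel_of {s t : LTerm G}
    (h : ∀ (H : Type u) [Group H] [Lattice H] [MulLeftMono H] [MulRightMono H], V H →
      ∀ p : G →* H, Monotone p → s.eval p = t.eval p) : LTerm.setoid V G s t :=
  ⟨fun H _ _ _ _ hH p hp => (h H hH p hp).le, fun H _ _ _ _ hH p hp => (h H hH p hp).ge⟩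

instance : Group (FreeLGroup V G) where
  mul := Quotient.map₂ (sa := LTerm.setoid V G) (sb := LTerm.setoid V G) (sc := LTerm.setoid V G)
    LTerm.mul (fun _ _ h₁ _ _ h₂ => rel_of fun H _ _ _ _ hH p hp =>
      congrArg₂ (· * ·) (eval_eq h₁ hH p hp) (eval_eq h₂ hH p hp))
  one := mk LTerm.one
  inv := Quotient.map (sa := LTerm.setoid V G) (sb := LTerm.setoid V G)
    LTerm.inv (fun _ _ h => rel_of fun H _ _ _ _ hH p hp =>
      congrArg (·⁻¹) (eval_eq h hH p hp))
  mul_assoc := by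
    rintro ⟨a⟩ ⟨b⟩ ⟨c⟩
    exact sound fun H _ _ _ _ _ p _ => mul_assoc _ _ _
  one_mul := by
    rintro ⟨a⟩
    exact sound fun H _ _ _ _ _ p _ => one_mul _
  mul_one := by
    rintro ⟨a⟩
    exact sound fun H _ _ _ _ _ p _ => mul_one _
  inv_mul_cancel := by
    rintro ⟨a⟩
    exact sound fun H _ _ _ _ _ p _ => inv_mul_cancel _

instance : Lattice (FreeLGroup V G) where
  le := Quotient.lift₂ (s₁ := LTerm.setoid V G) (s₂ := LTerm.setoid V G) (LTerm.Le V G)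
    (fun _ _ _ _ h₁ h₂ => propext
      ⟨fun h H _ _ _ _ hH p hp =>
        (h₁.2 H hH p hp).trans ((h H hH p hp).trans (h₂.1 H hH p hp)),
      fun h H _ _ _ _ hH p hp =>
        (h₁.1 H hH p hp).trans ((h H hH p hp).trans (h₂.2 H hH p hp))⟩)
  le_refl := by rintro ⟨a⟩ H _ _ _ _ hH p hp; exact le_rfl
  le_trans := by
    rintro ⟨a⟩ ⟨b⟩ ⟨c⟩ h₁ h₂ H _ _ _ _ hH p hp
    exact (h₁ H hH p hp).trans (h₂ H hH p hp)
  le_antisymm := by rintro ⟨a⟩ ⟨b⟩ h₁ h₂; exact Quotient.sound ⟨h₁, h₂⟩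
  sup := Quotient.map₂ (sa := LTerm.setoid V G) (sb := LTerm.setoid V G) (sc := LTerm.setoid V G)
    LTerm.sup (fun _ _ h₁ _ _ h₂ => rel_of fun H _ _ _ _ hH p hp =>
      congrArg₂ (· ⊔ ·) (eval_eq h₁ hH p hp) (eval_eq h₂ hH p hp))
  inf := Quotient.map₂ (sa := LTerm.setoid V G) (sb := LTerm.setoid V G) (sc := LTerm.setoid V G)
    LTerm.inf (fun _ _ h₁ _ _ h₂ => rel_of fun H _ _ _ _ hH p hp =>
      congrArg₂ (· ⊓ ·) (eval_eq h₁ hH p hp) (eval_eq h₂ hH p hp))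
  le_sup_left := by rintro ⟨a⟩ ⟨b⟩ H _ _ _ _ hH p hp; exact le_sup_left
  le_sup_right := by rintro ⟨a⟩ ⟨b⟩ H _ _ _ _ hH p hp; exact le_sup_right
  sup_le := by
    rintro ⟨a⟩ ⟨b⟩ ⟨c⟩ h₁ h₂ H _ _ _ _ hH p hp
    exact sup_le (h₁ H hH p hp) (h₂ H hH p hp)
  inf_le_left := by rintro ⟨a⟩ ⟨b⟩ H _ _ _ _ hH p hp; exact inf_le_left
  inf_le_right := by rintro ⟨a⟩ ⟨b⟩ H _ _ _ _ hH p hp; exact inf_le_right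
  le_inf := by
    rintro ⟨a⟩ ⟨b⟩ ⟨c⟩ h₁ h₂ H _ _ _ _ hH p hp
    exact le_inf (h₁ H hH p hp) (h₂ H hH p hp)

instance : MulLeftMono (FreeLGroup V G) := ⟨by
  rintro ⟨a⟩ ⟨b⟩ ⟨c⟩ h H _ _ _ _ hH p hp
  exact mul_le_mul_right (h H hH p hp) _⟩

instance : MulRightMono (FreeLGroup V G) := ⟨by
  rintro ⟨a⟩ ⟨b⟩ ⟨c⟩ h H _ _ _ _ hH p hp
  exact mul_le_mul_left (h H hH p hp) _⟩

variable (V G)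

/-- The universal map `η : G → F(G)`. -/
def eta : G →* FreeLGroup V G where
  toFun g := mk (LTerm.of g)
  map_one' := sound fun _ _ _ _ _ _ p _ => map_one p
  map_mul' a b := sound fun _ _ _ _ _ _ p _ => map_mul p a b

/-- The partially ordered group `η[G]`: the image of `G` under `η`, with the order restricted from
the free ℓ-group. -/
abbrev EtaImage : Type u := (eta V G).range

variable {V G}

theorem eta_monotone : Monotone (eta V G) :=
  fun _ _ h _ _ _ _ _ _ _ hp => hp h

/-- The ℓ-homomorphism from the free ℓ-group induced by a positive homomorphism. -/
def lift {H : Type u} [Group H] [Lattice H] [MulLeftMono H] [MulRightMono H] (hH : V H)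
    (p : G →* H) (hp : Monotone p) : FreeLGroup V G →* H where
  toFun := Quotient.lift (s := LTerm.setoid V G) (LTerm.eval p) (fun _ _ h => eval_eq h hH p hp)
  map_one' := rfl
  map_mul' := by rintro ⟨a⟩ ⟨b⟩; rfl

theorem lift_mk {H : Type u} [Group H] [Lattice H] [MulLeftMono H] [MulRightMono H] (hH : V H)
    (p : G →* H) (hp : Monotone p) (t : LTerm G) : lift hH p hp (mk t) = t.eval p := rfl

theorem lift_isLHom {H : Type u} [Group H] [Lattice H] [MulLeftMono H] [MulRightMono H] (hH : V H)
    (p : G →* H) (hp : Monotone p) : IsLHom (lift hH p hp) := by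
  constructor
  · rintro ⟨a⟩ ⟨b⟩; rfl
  · rintro ⟨a⟩ ⟨b⟩; rfl

/-- The universal property of the free ℓ-group over `G` in `V`. -/
theorem universal {H : Type u} [Group H] [Lattice H] [MulLeftMono H] [MulRightMono H] (hH : V H)
    (p : G →* H) (hp : Monotone p) :
    ∃! h : FreeLGroup V G →* H, IsLHom h ∧ h.comp (eta V G) = p := by
  refine ⟨lift hH p hp, ⟨lift_isLHom hH p hp, MonoidHom.ext fun _ => rfl⟩, ?_⟩
  rintro h ⟨hl, hc⟩
  refine MonoidHom.ext ?_
  rintro ⟨t⟩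
  change h (mk t) = t.eval p
  induction t with
  | of g => exact DFunLike.congr_fun hc g
  | one => exact map_one h
  | mul s t hs ht => exact (map_mul h (mk s) (mk t)).trans (congrArg₂ (· * ·) hs ht)
  | inv s hs => exact (map_inv h (mk s)).trans (congrArg (·⁻¹) hs)
  | sup s t hs ht => exact (hl.1 (mk s) (mk t)).trans (congrArg₂ (· ⊔ ·) hs ht)
  | inf s t hs ht => exact (hl.2 (mk s) (mk t)).trans (congrArg₂ (· ⊓ ·) hs ht)

theorem mem_all : AllLGroups (FreeLGroup AllLGroups G) := trivial

theorem mem_abelian : AbelianLGroups (FreeLGroup AbelianLGroups G) := by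
  rintro ⟨a⟩ ⟨b⟩
  exact sound fun H _ _ _ _ hH p _ => hH _ _

/-- Terms of the free representable ℓ-group are separated by positive homomorphisms to totally
ordered groups. -/
theorem exists_chain {s t : LTerm G} (h : ¬ (mk s : FreeLGroup RepresentableLGroups G) = mk t) :
    ∃ (K : Type u) (_ : Group K) (_ : LinearOrder K) (_ : MulLeftMono K) (_ : MulRightMono K)
      (f : FreeLGroup RepresentableLGroups G →* K),
      IsLHom f ∧ Function.Surjective f ∧ f (mk s) ≠ f (mk t) := by
  by_contra hne
  apply h
  refine sound fun H _ _ _ _ hH p hp => ?_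
  obtain ⟨ι, K, _, _, _, _, f, hf, -, hinj⟩ := id hH
  refine hinj _ _ fun i => ?_
  by_contra hst
  let g : FreeLGroup RepresentableLGroups G →* K i := (f i).comp (lift hH p hp)
  have hg : IsLHom g := by
    have hl := lift_isLHom hH p hp
    constructor
    · intro a b
      change f i (lift hH p hp (a ⊔ b)) = _
      rw [hl.1, (hf i).1]; rfl
    · intro a b
      change f i (lift hH p hp (a ⊓ b)) = _
      rw [hl.2, (hf i).2]; rfl
  refine hne ⟨g.range, inferInstance, inferInstance, ⟨fun a _ _ h => ?_⟩, ⟨fun a _ _ h => ?_⟩,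
    g.rangeRestrict, ⟨fun a b => ?_, fun a b => ?_⟩, g.rangeRestrict_surjective, fun he => ?_⟩
  · exact mul_le_mul_right (α := K i) h (a : K i)
  · exact mul_le_mul_left (α := K i) h (a : K i)
  · apply Subtype.ext
    exact (hg.1 a b).trans (Monotone.map_sup (f := fun x : g.range => (x : K i))
      (fun _ _ h => h) (g.rangeRestrict a) (g.rangeRestrict b)).symm
  · apply Subtype.ext
    exact (hg.2 a b).trans (Monotone.map_inf (f := fun x : g.range => (x : K i))
      (fun _ _ h => h) (g.rangeRestrict a) (g.rangeRestrict b)).symm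
  · exact hst (congrArg Subtype.val he)

theorem mem_representable :
    RepresentableLGroups (FreeLGroup RepresentableLGroups G) := by
  classical
  have key : ∀ i : {q : FreeLGroup RepresentableLGroups G × FreeLGroup RepresentableLGroups G //
      q.1 ≠ q.2},
      ∃ (K : Type u) (_ : Group K) (_ : LinearOrder K) (_ : MulLeftMono K) (_ : MulRightMono K)
      (f : FreeLGroup RepresentableLGroups G →* K),
      IsLHom f ∧ Function.Surjective f ∧ f i.1.1 ≠ f i.1.2 := by
    rintro ⟨⟨⟨s⟩, ⟨t⟩⟩, h⟩
    exact exists_chain h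
  choose K i₁ i₂ i₃ i₄ f h₁ h₂ h₃ using key
  refine ⟨_, K, i₁, i₂, i₃, i₄, f, h₁, h₂, fun a b hab => ?_⟩
  by_contra hne
  exact h₃ ⟨(a, b), hne⟩ (hab _)

end FreeLGroup

end Free

end RightPreorders

open RightPreorders

/-! **Idea.** A pre-cone `C` with `H_C ∈ V` contains every `a` with `η(a) ≥ 1`, so it is the preimage
of a pre-cone of `η[G]`.  The preimage of a right order is minimal, because a total cone properly
contained in it would force a nontrivial element and its inverse into the right order.  Conversely,
let `C` be minimal and suppose that `C ∩ C⁻¹` contains some `a` with `η(a) ≱ 1`.  Then `a` is missed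
by some pre-cone `D` of the class, and refining `C` lexicographically by `D` removes `a` from `C`,
against minimality.

The pre-cones `D` come from ℓ-groups in `V`.  In any ℓ-group an element `x ≱ 1` is missed by a
maximal cone filter, which is total; in a subdirect product of chains it is missed by the positive
cone of one of the factors.  For the representable and the Abelian variety the pre-cones with
`H_C ∈ V` have to be replaced by smaller ones that are normal, respectively contain all commutators.
These are ultralimits of pre-cones of `H_C`, taken along the upward directed set of the elements of
`H_C` that lower the class of `1`. -/

namespace RightPreorders

open scoped commutatorElement

/-! ### Constructions of pre-cones -/

namespace PreCone

section Constructions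

variable {G G' : Type*} [Group G] [PartialOrder G] [Group G'] [PartialOrder G']

theorem pos_mem (C : PreCone G) {a : G} (ha : 1 ≤ a) : a ∈ C := C.pos_mem' a ha

theorem inv_mem_of_notMem (C : PreCone G) {a : G} (ha : a ∉ C) : a⁻¹ ∈ C :=
  (C.total' a).resolve_left ha

theorem exists_notMem (C : PreCone G) : ∃ a, a ∉ C :=
  (Set.ne_univ_iff_exists_notMem _).1 C.proper'

theorem mem_of_le [MulRightMono G] (C : PreCone G) {a b : G} (ha : a ∈ C) (hab : a ≤ b) :
    b ∈ C := by
  simpa using C.mul_mem (C.pos_mem (le_mul_inv_iff_le.2 hab)) ha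

/-- The preimage of a pre-cone under a positive homomorphism whose image it does not contain. -/
def comap (f : G →* G') (hf : Monotone f) (D : PreCone G') (hD : ∃ a, f a ∉ D) : PreCone G where
  toSubmonoid := D.toSubmonoid.comap f
  proper' h := hD.elim fun a ha => ha (h.ge (Set.mem_univ a))
  total' a := by
    change f a ∈ D ∨ f a⁻¹ ∈ D
    rw [map_inv]
    exact D.total' (f a)
  pos_mem' a ha := D.pos_mem ((map_one f).ge.trans (hf ha))

theorem mem_comap {f : G →* G'} {hf : Monotone f} {D : PreCone G'} {hD : ∃ a, f a ∉ D} {a : G} :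
    a ∈ D.comap f hf hD ↔ f a ∈ D := Iff.rfl

theorem exists_map_notMem {α : Type*} (D : PreCone G') {f : α → G'} (hs : Function.Surjective f) :
    ∃ a, f a ∉ D :=
  hs.exists.1 D.exists_notMem

theorem isEmbedding_comap (f : G →* G') (hf : Monotone f) (hs : Function.Surjective f) :
    Topology.IsEmbedding fun D : PreCone G' => D.comap f hf (D.exists_map_notMem hs) := by
  refine ⟨⟨Eq.trans (congrArg TopologicalSpace.generateFrom ?_) induced_generateFrom_eq.symm⟩,
    fun D E h => SetLike.ext (hs.forall.2 (SetLike.ext_iff.1 h))⟩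
  rw [← Set.range_comp, ← hs.range_comp]
  refine congrArg Set.range (funext fun a => Set.ext fun D => ?_)
  simp [mem_comap]

/-- The lexicographic refinement of the pre-cone `C` by the pre-cone `D`: membership of the elements
of `C ∩ C⁻¹` is decided by `D`. -/
def lex (C D : PreCone G) : PreCone G where
  carrier := {a | a ∈ C ∧ (a⁻¹ ∈ C → a ∈ D)}
  one_mem' := ⟨C.one_mem, fun _ => D.one_mem⟩
  mul_mem' := by
    rintro a b ⟨ha, ha'⟩ ⟨hb, hb'⟩
    refine ⟨C.mul_mem ha hb, fun h => ?_⟩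
    have hainv : a⁻¹ ∈ C := by simpa using C.mul_mem hb h
    have hbinv : b⁻¹ ∈ C := by simpa using C.mul_mem h ha
    exact D.mul_mem (ha' hainv) (hb' hbinv)
  proper' h := C.exists_notMem.elim fun a ha => ha (h.ge (Set.mem_univ a)).1
  total' a := by
    by_cases ha : a ∈ C
    · by_cases ha' : a⁻¹ ∈ C
      · exact (D.total' a).imp (fun h => ⟨ha, fun _ => h⟩) (fun h => ⟨ha', fun _ => h⟩)
      · exact Or.inl ⟨ha, fun h => absurd h ha'⟩
    · exact Or.inr ⟨C.inv_mem_of_notMem ha, fun h => absurd (by simpa using h) ha⟩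
  pos_mem' a ha := ⟨C.pos_mem ha, fun _ => D.pos_mem ha⟩

theorem lex_le (C D : PreCone G) : C.lex D ≤ C := fun _ h => h.1

/-- The limit of a family of pre-cones along an ultrafilter.  It is a pre-cone as soon as some
element is eventually missed. -/
def ultralimit {ι : Type*} (U : Ultrafilter ι) (C : ι → PreCone G)
    (hC : ∃ a, ∀ᶠ i in U, a ∉ C i) : PreCone G where
  carrier := {a | ∀ᶠ i in U, a ∈ C i}
  one_mem' := .of_forall fun i => (C i).one_mem
  mul_mem' ha hb := by filter_upwards [ha, hb] with i using (C i).mul_mem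
  proper' h := hC.elim fun a ha => Ultrafilter.eventually_not.1 ha (h.ge (Set.mem_univ a))
  total' a := Ultrafilter.eventually_or.1 (.of_forall fun i => (C i).total' a)
  pos_mem' _ ha := .of_forall fun i => (C i).pos_mem ha

/-- The positive cone of a nontrivial totally ordered group, as a pre-cone. -/
def oneLE (K : Type*) [Group K] [LinearOrder K] [MulLeftMono K] (hK : ∃ x : K, ¬1 ≤ x) :
    PreCone K where
  toSubmonoid := Submonoid.oneLE K
  proper' h := hK.elim fun x hx => hx (h.ge (Set.mem_univ x))
  total' x := by simpa using le_total 1 x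
  pos_mem' _ hx := hx

end Constructions

section Normal

variable {G G' : Type*} [Group G] [PartialOrder G] [Group G'] [PartialOrder G']

theorem isNormal_oneLE {K : Type*} [Group K] [LinearOrder K] [MulLeftMono K] [MulRightMono K]
    (hK : ∃ x : K, ¬1 ≤ x) : (oneLE K hK).IsNormal := fun a ha g => by
  have hga : 1 ≤ g * a * g⁻¹ := by
    simpa using mul_le_mul_left (mul_le_mul_right (show 1 ≤ a from ha) g) g⁻¹
  exact hga

theorem IsNormal.comap {D : PreCone G'} (hD : D.IsNormal) {f : G →* G'} {hf : Monotone f}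
    {hne : ∃ a, f a ∉ D} : (D.comap f hf hne).IsNormal := fun a ha g => by
  simpa [mem_comap] using hD _ ha (f g)

theorem IsNormal.of_comap {D : PreCone G'} {f : G →* G'} {hf : Monotone f} {hne : ∃ a, f a ∉ D}
    (h : (D.comap f hf hne).IsNormal) (hs : Function.Surjective f) : D.IsNormal := by
  refine hs.forall.2 fun a ha => hs.forall.2 fun g => ?_
  simpa [mem_comap] using h a ha g

theorem IsNormal.lex {C D : PreCone G} (hC : C.IsNormal) (hD : D.IsNormal) :
    (C.lex D).IsNormal := by
  rintro a ⟨ha, ha'⟩ g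
  refine ⟨hC a ha g, fun h => hD a (ha' ?_) g⟩
  simpa [mul_assoc] using hC _ h g⁻¹

theorem IsNormal.ultralimit {ι : Type*} {U : Ultrafilter ι} {C : ι → PreCone G}
    {hne : ∃ a, ∀ᶠ i in U, a ∉ C i} (hC : ∀ i, (C i).IsNormal) :
    (ultralimit U C hne).IsNormal := fun a ha g =>
  Filter.Eventually.mono ha fun i hi => hC i a hi g

/-- The pre-cone `C` contains all commutators; equivalently, its right pre-order induces a total
order on an Abelian quotient of `G`. -/
def ContainsCommutators (C : PreCone G) : Prop := ∀ a b : G, ⁅a, b⁆ ∈ C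

theorem containsCommutators_of_commute (hG : ∀ a b : G, a * b = b * a) (C : PreCone G) :
    C.ContainsCommutators := fun a b => by
  rw [commutatorElement_eq_one_iff_mul_comm.2 (hG a b)]
  exact C.one_mem

theorem ContainsCommutators.isNormal {C : PreCone G} (hC : C.ContainsCommutators) : C.IsNormal :=
  fun a ha g => by simpa [commutatorElement_def] using C.mul_mem (hC g a) ha

theorem ContainsCommutators.comap {D : PreCone G'} (hD : D.ContainsCommutators) {f : G →* G'}
    {hf : Monotone f} {hne : ∃ a, f a ∉ D} : (D.comap f hf hne).ContainsCommutators := fun a b => by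
  simpa only [mem_comap, map_commutatorElement] using hD (f a) (f b)

theorem ContainsCommutators.of_comap {D : PreCone G'} {f : G →* G'} {hf : Monotone f}
    {hne : ∃ a, f a ∉ D} (h : (D.comap f hf hne).ContainsCommutators)
    (hs : Function.Surjective f) : D.ContainsCommutators := by
  refine hs.forall.2 fun a => hs.forall.2 fun b => ?_
  simpa only [mem_comap, map_commutatorElement] using h a b

end Normal

end PreCone

/-! ### The ℓ-group of a pre-cone -/

namespace PreCone

variable {G : Type*} [Group G] [PartialOrder G]

/-- The homomorphism `G → H_C` obtained from `ρ_C` by restricting its codomain. -/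
noncomputable def toLGroupOf (C : PreCone G) : G →* C.LGroupOf :=
  C.rho.codRestrict _ fun a _ hK => hK ⟨a, rfl⟩

theorem toLGroupOf_le_iff (C : PreCone G) {a b : G} :
    C.toLGroupOf a ≤ C.toLGroupOf b ↔ ∀ c : G, c * (b * a⁻¹) * c⁻¹ ∈ C := by
  have hcls (c : G) : C.cls (c * a) ≤ C.cls (c * b) ↔ c * (b * a⁻¹) * c⁻¹ ∈ C := by
    simp [cls_le_cls, mul_assoc]
  refine ⟨fun h c => (hcls c).1 (h (C.cls c)), ?_⟩
  rintro h ⟨c⟩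
  exact (hcls c).2 (h c)

theorem monotone_toLGroupOf [MulLeftMono G] [MulRightMono G] (C : PreCone G) :
    Monotone C.toLGroupOf := fun a b hab => by
  refine C.toLGroupOf_le_iff.2 fun c => C.pos_mem ?_
  simpa using mul_le_mul_left (mul_le_mul_right (le_mul_inv_iff_le.2 hab) c) c⁻¹

theorem one_le_toLGroupOf_apply_iff (C : PreCone G) {a : G} :
    C.cls 1 ≤ (C.toLGroupOf a).1 (C.cls 1) ↔ a ∈ C := by
  change C.cls 1 ≤ C.cls (1 * a) ↔ a ∈ C
  simp [cls_le_cls]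

theorem IsNormal.toLGroupOf_le_iff {C : PreCone G} (hC : C.IsNormal) {a b : G} :
    C.toLGroupOf a ≤ C.toLGroupOf b ↔ b * a⁻¹ ∈ C := by
  rw [PreCone.toLGroupOf_le_iff]
  exact ⟨fun h => by simpa using h 1, fun h => hC _ h⟩

theorem IsNormal.toLGroupOf_le_total {C : PreCone G} (hC : C.IsNormal) (a b : G) :
    C.toLGroupOf a ≤ C.toLGroupOf b ∨ C.toLGroupOf b ≤ C.toLGroupOf a := by
  rw [hC.toLGroupOf_le_iff, hC.toLGroupOf_le_iff]
  exact C.rel_total a b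

theorem IsNormal.toLGroupOf_surjective {C : PreCone G} (hC : C.IsNormal) :
    Function.Surjective C.toLGroupOf := by
  let K : LSubgroup (ChainAut C.Chain) :=
    { C.rho.range with
      sup_mem' := by
        rintro _ _ ⟨a, rfl⟩ ⟨b, rfl⟩
        rcases hC.toLGroupOf_le_total a b with h | h
        · exact ⟨b, congrArg Subtype.val (sup_eq_right.2 h).symm⟩
        · exact ⟨a, congrArg Subtype.val (sup_eq_left.2 h).symm⟩
      inf_mem' := by
        rintro _ _ ⟨a, rfl⟩ ⟨b, rfl⟩
        rcases hC.toLGroupOf_le_total a b with h | h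
        · exact ⟨a, congrArg Subtype.val (inf_eq_left.2 h).symm⟩
        · exact ⟨b, congrArg Subtype.val (inf_eq_right.2 h).symm⟩ }
  rintro ⟨x, hx⟩
  obtain ⟨a, ha⟩ := hx K fun _ h => h
  exact ⟨a, Subtype.ext ha⟩

end PreCone

theorem representableLGroups_of_le_total {H : Type*} [Group H] [Lattice H] [MulLeftMono H]
    [MulRightMono H] (hH : ∀ a b : H, a ≤ b ∨ b ≤ a) : RepresentableLGroups H := by
  classical
  have : Std.Total (α := H) (· ≤ ·) := ⟨hH⟩
  exact ⟨PUnit, fun _ => H, fun _ => inferInstance, fun _ => Lattice.toLinearOrder H,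
    fun _ => ‹_›, fun _ => ‹_›, fun _ => MonoidHom.id H, fun _ => ⟨fun _ _ => rfl, fun _ _ => rfl⟩,
    fun _ => Function.surjective_id, fun _ _ h => h PUnit.unit⟩

namespace PreCone

variable {G : Type*} [Group G] [PartialOrder G]

theorem IsNormal.mem_vPreCones {C : PreCone G} (hC : C.IsNormal) :
    C ∈ VPreCones G RepresentableLGroups :=
  representableLGroups_of_le_total
    (hC.toLGroupOf_surjective.forall₂.2 hC.toLGroupOf_le_total)

theorem ContainsCommutators.mem_vPreCones {C : PreCone G} (hC : C.ContainsCommutators) :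
    C ∈ VPreCones G AbelianLGroups := by
  have hle (a b : G) : C.toLGroupOf (a * b) ≤ C.toLGroupOf (b * a) :=
    hC.isNormal.toLGroupOf_le_iff.2 (by simpa [commutatorElement_def, mul_assoc] using hC b a)
  refine hC.isNormal.toLGroupOf_surjective.forall₂.2 fun a b => ?_
  rw [← map_mul, ← map_mul]
  exact le_antisymm (hle a b) (hle b a)

end PreCone

/-! ### Separation in ℓ-groups -/

section ConeFilters

variable {H : Type*} [Group H] [Lattice H]

/-- A cone filter: a submonoid of an ℓ-group that contains the positive cone and is closed under
`a ↦ a ⊓ 1`.  These are the upward closed submonoids determined by their elements below `1`, which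
in turn form the negative cone of a convex ℓ-subgroup. -/
structure IsConeFilter (M : Submonoid H) : Prop where
  pos_mem : ∀ ⦃a⦄, 1 ≤ a → a ∈ M
  inf_one_mem : ∀ ⦃a⦄, a ∈ M → a ⊓ 1 ∈ M

theorem IsConeFilter.mem_of_le [MulRightMono H] {M : Submonoid H} (hM : IsConeFilter M) {a b : H}
    (ha : a ∈ M) (hab : a ≤ b) : b ∈ M := by
  simpa using M.mul_mem (hM.pos_mem (le_mul_inv_iff_le.2 hab)) ha

theorem isConeFilter_oneLE [MulLeftMono H] : IsConeFilter (Submonoid.oneLE H) :=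
  ⟨fun _ ha => ha, fun _ ha => le_inf ha le_rfl⟩

theorem isConeFilter_sSup {c : Set (Submonoid H)} (hc : ∀ M ∈ c, IsConeFilter M)
    (hne : c.Nonempty) (hdir : DirectedOn (· ≤ ·) c) : IsConeFilter (sSup c) where
  pos_mem _ ha := hne.elim fun M hM => le_sSup hM ((hc M hM).pos_mem ha)
  inf_one_mem _ ha := by
    obtain ⟨M, hM, haM⟩ := (Submonoid.mem_sSup_of_directedOn hne hdir).1 ha
    exact le_sSup hM ((hc M hM).inf_one_mem haM)

theorem exists_maximal_isConeFilter_notMem [MulLeftMono H] {x : H} (hx : ¬1 ≤ x) :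
    ∃ M : Submonoid H, Maximal (fun M => IsConeFilter M ∧ x ∉ M) M := by
  refine (zorn_le_nonempty₀ {M | IsConeFilter M ∧ x ∉ M} (fun c hc hchain M₀ hM₀ => ?_) _
    ⟨isConeFilter_oneLE, hx⟩).imp fun _ => And.right
  have hne : c.Nonempty := ⟨M₀, hM₀⟩
  refine ⟨sSup c, ⟨isConeFilter_sSup (fun M hM => (hc hM).1) hne hchain.directedOn, fun h => ?_⟩,
    fun M => le_sSup⟩
  obtain ⟨M, hM, hxM⟩ := (Submonoid.mem_sSup_of_directedOn hne hchain.directedOn).1 h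
  exact (hc hM).2 hxM

variable [MulLeftMono H] [MulRightMono H]

theorem sup_pow_le_sup_pow {a b : H} (ha : a ≤ 1) (hb : b ≤ 1) (k : ℕ) :
    (a ⊔ b) ^ k ≤ a ⊔ b ^ k := by
  induction k with
  | zero => simp
  | succ k ih =>
    calc (a ⊔ b) ^ (k + 1) = (a ⊔ b) ^ k * (a ⊔ b) := pow_succ _ _
      _ ≤ (a ⊔ b ^ k) * (a ⊔ b) := mul_le_mul_left ih _
      _ = a * (a ⊔ b) ⊔ (b ^ k * a ⊔ b ^ k * b) := by rw [sup_mul, mul_sup _ _ (b ^ k)]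
      _ ≤ a ⊔ (a ⊔ b ^ (k + 1)) := by
        rw [← pow_succ]
        exact sup_le_sup (mul_le_of_le_one_right' (sup_le ha hb))
          (sup_le_sup_right (mul_le_of_le_one_left' (pow_le_one' hb k)) _)
      _ = a ⊔ b ^ (k + 1) := by rw [← sup_assoc, sup_idem]

theorem sup_pow_mul_le_sup {a b : H} (ha : a ≤ 1) (hb : b ≤ 1) (k l : ℕ) :
    (a ⊔ b) ^ (k * l) ≤ a ^ k ⊔ b ^ l :=
  calc (a ⊔ b) ^ (k * l) = ((b ⊔ a) ^ k) ^ l := by rw [sup_comm, pow_mul]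
    _ ≤ (a ^ k ⊔ b) ^ l := pow_le_pow_left' ((sup_pow_le_sup_pow hb ha k).trans_eq (sup_comm _ _)) l
    _ ≤ a ^ k ⊔ b ^ l := sup_pow_le_sup_pow (pow_le_one' ha k) hb l

/-- The cone filter generated by the cone filter `M` and the element `u`. -/
def coneFilterAdjoin (M : Submonoid H) (u : H) : Submonoid H where
  carrier := {h | ∃ n ∈ M, n ≤ 1 ∧ ∃ k : ℕ, (n * (u ⊓ 1)) ^ k ≤ h}
  one_mem' := ⟨1, M.one_mem, le_rfl, 0, by simp⟩
  mul_mem' := by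
    rintro a b ⟨n, hn, hn₁, k, hk⟩ ⟨m, hm, hm₁, l, hl⟩
    refine ⟨n * m, M.mul_mem hn hm, mul_le_one' hn₁ hm₁, k + l, ?_⟩
    calc (n * m * (u ⊓ 1)) ^ (k + l) = (n * m * (u ⊓ 1)) ^ k * (n * m * (u ⊓ 1)) ^ l := pow_add ..
      _ ≤ (n * (u ⊓ 1)) ^ k * (m * (u ⊓ 1)) ^ l := by
        gcongr
        · exact mul_le_of_le_one_right' hm₁
        · exact mul_le_of_le_one_left' hn₁
      _ ≤ a * b := mul_le_mul' hk hl

theorem isConeFilter_coneFilterAdjoin (M : Submonoid H) (u : H) :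
    IsConeFilter (coneFilterAdjoin M u) where
  pos_mem a ha := ⟨1, M.one_mem, le_rfl, 0, by simpa using ha⟩
  inf_one_mem := by
    rintro a ⟨n, hn, hn₁, k, hk⟩
    exact ⟨n, hn, hn₁, k, le_inf hk (pow_le_one' (mul_le_one' hn₁ inf_le_right) k)⟩

theorem mem_coneFilterAdjoin (M : Submonoid H) (u : H) : u ∈ coneFilterAdjoin M u :=
  ⟨1, M.one_mem, le_rfl, 1, by simp⟩

theorem IsConeFilter.le_coneFilterAdjoin {M : Submonoid H} (hM : IsConeFilter M) (u : H) :
    M ≤ coneFilterAdjoin M u := fun a ha =>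
  ⟨a ⊓ 1, hM.inf_one_mem ha, inf_le_right, 1, by
    rw [pow_one]
    exact (mul_le_of_le_one_right' inf_le_right).trans inf_le_left⟩

theorem inf_one_sup_inv_inf_one (u : H) : (u ⊓ 1) ⊔ (u⁻¹ ⊓ 1) = 1 := by
  simpa [oneLePart, leOnePart, inv_inf, inv_sup, sup_comm] using
    congrArg (·⁻¹) (oneLePart_inf_leOnePart_eq_one u)

theorem IsConeFilter.coneFilterAdjoin_inf_coneFilterAdjoin_inv_le {M : Submonoid H}
    (hM : IsConeFilter M) (u : H) : coneFilterAdjoin M u ⊓ coneFilterAdjoin M u⁻¹ ≤ M := by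
  rintro x ⟨⟨n, hn, hn₁, k, hk⟩, m, hm, hm₁, l, hl⟩
  have hnm : n * m ≤ 1 := mul_le_one' hn₁ hm₁
  refine hM.mem_of_le (M.pow_mem (M.mul_mem hn hm) (k * l)) ?_
  calc (n * m) ^ (k * l) = (n * m * (u ⊓ 1) ⊔ n * m * (u⁻¹ ⊓ 1)) ^ (k * l) := by
        rw [← mul_sup, inf_one_sup_inv_inf_one, mul_one]
    _ ≤ (n * m * (u ⊓ 1)) ^ k ⊔ (n * m * (u⁻¹ ⊓ 1)) ^ l :=
        sup_pow_mul_le_sup (mul_le_one' hnm inf_le_right) (mul_le_one' hnm inf_le_right) k l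
    _ ≤ (n * (u ⊓ 1)) ^ k ⊔ (m * (u⁻¹ ⊓ 1)) ^ l := by
        gcongr
        · exact mul_le_of_le_one_right' hm₁
        · exact mul_le_of_le_one_left' hn₁
    _ ≤ x := sup_le hk hl

theorem mem_or_inv_mem_of_maximal_isConeFilter {x : H} {M : Submonoid H}
    (hM : Maximal (fun M => IsConeFilter M ∧ x ∉ M) M) (u : H) : u ∈ M ∨ u⁻¹ ∈ M := by
  have hadjoin {v : H} (hv : v ∉ M) : x ∈ coneFilterAdjoin M v := by
    by_contra hxv
    exact hv (hM.le_of_ge ⟨isConeFilter_coneFilterAdjoin M v, hxv⟩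
      (hM.prop.1.le_coneFilterAdjoin v) (mem_coneFilterAdjoin M v))
  by_contra! hu
  exact hM.prop.2 (hM.prop.1.coneFilterAdjoin_inf_coneFilterAdjoin_inv_le u
    ⟨hadjoin hu.1, hadjoin hu.2⟩)

theorem exists_preCone_notMem {x : H} (hx : ¬1 ≤ x) : ∃ C : PreCone H, x ∉ C := by
  obtain ⟨M, hM⟩ := exists_maximal_isConeFilter_notMem hx
  exact ⟨{  toSubmonoid := M
            proper' := fun h => hM.prop.2 (h.ge (Set.mem_univ x))
            total' := mem_or_inv_mem_of_maximal_isConeFilter hM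
            pos_mem' := hM.prop.1.pos_mem }, hM.prop.2⟩

end ConeFilters

section Representable

variable {H : Type*} [Group H] [Lattice H]

theorem IsLHom.monotone {K : Type*} [Group K] [Lattice K] {f : H →* K} (hf : IsLHom f) :
    Monotone f := fun a b hab => by
  rw [← sup_eq_right, ← hf.1, sup_eq_right.2 hab]

theorem one_le_of_forall_one_le_map {ι : Type*} {K : ι → Type*} [∀ i, Group (K i)]
    [∀ i, Lattice (K i)] {f : ∀ i, H →* K i} (hf : ∀ i, IsLHom (f i))
    (hinj : ∀ a b : H, (∀ i, f i a = f i b) → a = b) {a : H} (ha : ∀ i, 1 ≤ f i a) : 1 ≤ a := by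
  rw [← inf_eq_left]
  refine hinj _ _ fun i => ?_
  rw [(hf i).2, map_one, inf_eq_left.2 (ha i)]

theorem RepresentableLGroups.exists_isNormal_notMem [MulLeftMono H] [MulRightMono H]
    (hH : RepresentableLGroups H) {x : H} (hx : ¬1 ≤ x) : ∃ C : PreCone H, C.IsNormal ∧ x ∉ C := by
  obtain ⟨ι, K, _, _, _, _, f, hf, -, hinj⟩ := hH
  obtain ⟨i, hi⟩ : ∃ i, ¬1 ≤ f i x := by
    by_contra! h
    exact hx (one_le_of_forall_one_le_map hf hinj h)
  exact ⟨(PreCone.oneLE (K i) ⟨_, hi⟩).comap (f i) (hf i).monotone ⟨x, hi⟩,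
    (PreCone.isNormal_oneLE _).comap, hi⟩

end Representable

/-! ### Classes of pre-cones adapted to a class of ℓ-groups -/

/-- A class of pre-cones of partially ordered groups. -/
abbrev PreConeClass : Type (u + 1) := ∀ (G : Type u) [Group G] [PartialOrder G], Set (PreCone G)

/-- The class `Q` of pre-cones is adapted to the class `V` of ℓ-groups: it is stable under
preimages, images, lexicographic refinements and ultralimits, each `C` in `Q` has `H_C` in `V`, and
in an ℓ-group in `V` every element that is not above `1` is missed by some pre-cone in `Q`. -/
structure PreConeClass.IsAdaptedTo (Q : PreConeClass.{u}) (V : LGroupClass.{u}) : Prop where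
  comap_mem : ∀ {G G' : Type u} [Group G] [PartialOrder G] [Group G'] [PartialOrder G']
    {f : G →* G'} {hf : Monotone f} {D : PreCone G'} {hD : ∃ a, f a ∉ D},
    D ∈ Q G' → D.comap f hf hD ∈ Q G
  of_comap_mem : ∀ {G G' : Type u} [Group G] [PartialOrder G] [Group G'] [PartialOrder G']
    {f : G →* G'} {hf : Monotone f} {D : PreCone G'} {hD : ∃ a, f a ∉ D},
    Function.Surjective f → D.comap f hf hD ∈ Q G → D ∈ Q G'
  lex_mem : ∀ {G : Type u} [Group G] [PartialOrder G] {C D : PreCone G},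
    C ∈ Q G → D ∈ Q G → C.lex D ∈ Q G
  ultralimit_mem : ∀ {G : Type u} [Group G] [PartialOrder G] {ι : Type u} {U : Ultrafilter ι}
    {C : ι → PreCone G} {hC : ∃ a, ∀ᶠ i in U, a ∉ C i},
    (∀ i, C i ∈ Q G) → PreCone.ultralimit U C hC ∈ Q G
  subset_vPreCones : ∀ {G : Type u} [Group G] [PartialOrder G], Q G ⊆ VPreCones G V
  exists_notMem : ∀ {H : Type u} [Group H] [Lattice H] [MulLeftMono H] [MulRightMono H], V H →
    ∀ {x : H}, ¬1 ≤ x → ∃ C ∈ Q H, x ∉ C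

namespace PreConeClass

theorem univ_isAdaptedTo_allLGroups :
    IsAdaptedTo.{u} (fun _ _ _ => Set.univ) AllLGroups where
  comap_mem _ := trivial
  of_comap_mem _ _ := trivial
  lex_mem _ _ := trivial
  ultralimit_mem _ := trivial
  subset_vPreCones _ := trivial
  exists_notMem _ _ hx := (exists_preCone_notMem hx).imp fun _ h => ⟨trivial, h⟩

theorem isNormal_isAdaptedTo_representableLGroups :
    IsAdaptedTo.{u} (fun _ _ _ => {C | C.IsNormal}) RepresentableLGroups where
  comap_mem hD := hD.comap
  of_comap_mem hs hD := hD.of_comap hs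
  lex_mem hC hD := hC.lex hD
  ultralimit_mem hC := .ultralimit hC
  subset_vPreCones hC := hC.mem_vPreCones
  exists_notMem hH _ hx := hH.exists_isNormal_notMem hx

theorem containsCommutators_isAdaptedTo_abelianLGroups :
    IsAdaptedTo.{u} (fun _ _ _ => {C | C.ContainsCommutators}) AbelianLGroups where
  comap_mem hD := hD.comap
  of_comap_mem hs hD := hD.of_comap hs
  lex_mem hC hD a b := ⟨hC a b, fun _ => hD a b⟩
  ultralimit_mem hC a b := .of_forall fun i => hC i a b
  subset_vPreCones hC := hC.mem_vPreCones
  exists_notMem hH _ hx := (exists_preCone_notMem hx).imp fun C h =>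
    ⟨C.containsCommutators_of_commute hH, h⟩

namespace IsAdaptedTo

variable {Q : PreConeClass.{u}} {V : LGroupClass.{u}}

theorem exists_disjoint_of_directedOn (hQ : Q.IsAdaptedTo V) {H : Type u} [Group H] [Lattice H]
    [MulLeftMono H] [MulRightMono H] (hH : V H) {I : Set H} (hne : I.Nonempty)
    (hdir : DirectedOn (· ≤ ·) I) (hI : ∀ x ∈ I, ¬1 ≤ x) :
    ∃ D ∈ Q H, Disjoint (D : Set H) I := by
  choose C hCQ hC using fun x : I => hQ.exists_notMem hH (hI x x.2)
  have := hne.to_subtype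
  have := hdir.isDirectedOrder
  let U : Ultrafilter I := .of Filter.atTop
  have hU (x : I) : ∀ᶠ y in U, (x : H) ∉ C y :=
    ((Filter.eventually_ge_atTop x).filter_mono (Ultrafilter.of_le _)).mono
      fun y hxy hx => hC y ((C y).mem_of_le hx hxy)
  obtain ⟨x₀, hx₀⟩ := hne
  refine ⟨.ultralimit U C ⟨x₀, hU ⟨x₀, hx₀⟩⟩, hQ.ultralimit_mem hCQ,
    Set.disjoint_right.2 fun x hx => Ultrafilter.eventually_not.1 (hU ⟨x, hx⟩)⟩

variable {G : Type u} [Group G] [PartialOrder G]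

theorem exists_mem_le [MulLeftMono G] [MulRightMono G] (hQ : Q.IsAdaptedTo V) {C : PreCone G}
    (hC : C ∈ VPreCones G V) : ∃ D ∈ Q G, D ≤ C := by
  let I : Set C.LGroupOf := {h | h.1 (C.cls 1) < C.cls 1}
  have hmem {a : G} : C.toLGroupOf a ∈ I ↔ a ∉ C :=
    not_le.symm.trans C.one_le_toLGroupOf_apply_iff.not
  have hsup : SupClosed I := fun g hg h hh =>
    (max_lt hg hh : g.1 (C.cls 1) ⊔ h.1 (C.cls 1) < C.cls 1)
  obtain ⟨a, ha⟩ := C.exists_notMem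
  obtain ⟨D, hDQ, hDI⟩ := hQ.exists_disjoint_of_directedOn hC ⟨_, hmem.2 ha⟩ hsup.directedOn
    fun h hh h1 => hh.not_ge (h1 (C.cls 1))
  refine ⟨D.comap C.toLGroupOf C.monotone_toLGroupOf
    ⟨a, Set.disjoint_right.1 hDI (hmem.2 ha)⟩, hQ.comap_mem hDQ, fun b hb => ?_⟩
  exact not_not.1 fun hbC => Set.disjoint_left.1 hDI hb (hmem.2 hbC)

theorem one_le_eta_of_forall_mem (hQ : Q.IsAdaptedTo V) {a : G} (ha : ∀ C ∈ Q G, a ∈ C) :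
    1 ≤ FreeLGroup.eta V G a := fun H _ _ _ _ hH p hp => by
  by_contra hpa
  obtain ⟨D, hDQ, hD⟩ := hQ.exists_notMem hH hpa
  exact hD (ha (D.comap p hp ⟨a, hD⟩) (hQ.comap_mem hDQ))

end IsAdaptedTo

end PreConeClass

/-! ### The minimal layer -/

section MinimalLayer

variable {V : LGroupClass.{u}} {G : Type u} [Group G] [PartialOrder G]

/-- The map `η` onto its image. -/
abbrev etaRange (V : LGroupClass.{u}) (G : Type u) [Group G] [PartialOrder G] :
    G →* FreeLGroup.EtaImage V G := (FreeLGroup.eta V G).rangeRestrict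

theorem etaRange_surjective : Function.Surjective (etaRange V G) :=
  (FreeLGroup.eta V G).rangeRestrict_surjective

theorem etaRange_monotone : Monotone (etaRange V G) := fun _ _ h => FreeLGroup.eta_monotone h

/-- The preimage under `η` of a pre-cone of `η[G]`. -/
abbrev etaComap (D : PreCone (FreeLGroup.EtaImage V G)) : PreCone G :=
  D.comap (etaRange V G) etaRange_monotone (D.exists_map_notMem etaRange_surjective)

variable [MulLeftMono G] [MulRightMono G]

theorem PreCone.mem_of_one_le_eta {C : PreCone G} (hC : C ∈ VPreCones G V) {a : G}
    (ha : 1 ≤ FreeLGroup.eta V G a) : a ∈ C := by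
  have h : 1 ≤ C.toLGroupOf a := ha C.LGroupOf hC C.toLGroupOf C.monotone_toLGroupOf
  exact C.one_le_toLGroupOf_apply_iff.1 (h (C.cls 1))

theorem PreCone.mem_of_etaRange_le {C : PreCone G} (hC : C ∈ VPreCones G V) {a b : G} (ha : a ∈ C)
    (hab : etaRange V G a ≤ etaRange V G b) : b ∈ C := by
  have h : 1 ≤ FreeLGroup.eta V G (b * a⁻¹) := by
    rw [map_mul, map_inv]
    exact le_mul_inv_iff_le.2 hab
  simpa using C.mul_mem (mem_of_one_le_eta hC h) ha

theorem PreCone.exists_etaComap_eq {C : PreCone G} (hC : C ∈ VPreCones G V) :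
    ∃ D : PreCone (FreeLGroup.EtaImage V G), etaComap D = C := by
  let M : Submonoid (FreeLGroup.EtaImage V G) := C.toSubmonoid.map (etaRange V G)
  have hM {a : G} : etaRange V G a ∈ M ↔ a ∈ C :=
    ⟨fun ⟨_, hb, hba⟩ => mem_of_etaRange_le hC hb hba.le, fun ha => ⟨a, ha, rfl⟩⟩
  obtain ⟨x, hx⟩ := C.exists_notMem
  refine ⟨⟨M, fun h => hx (hM.1 (h.ge (Set.mem_univ _))), ?_, ?_⟩, SetLike.ext fun a => hM⟩
  · refine etaRange_surjective.forall.2 fun a => ?_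
    change etaRange V G a ∈ M ∨ (etaRange V G a)⁻¹ ∈ M
    rw [← map_inv, hM, hM]
    exact C.total' a
  · refine etaRange_surjective.forall.2 fun a ha => hM.2 (mem_of_one_le_eta hC ha)

theorem PreCone.IsRightOrder.le_of_le_etaComap {D : PreCone (FreeLGroup.EtaImage V G)}
    (hD : D.IsRightOrder) {C : PreCone G} (hC : C ∈ VPreCones G V) (hCD : C ≤ etaComap D) :
    etaComap D ≤ C := fun a ha => by
  by_contra haC
  have hinv : (etaRange V G a)⁻¹ ∈ D := by
    rw [← map_inv]
    exact hCD (C.inv_mem_of_notMem haC)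
  have hone : etaRange V G a = 1 := hD _ ha hinv
  exact haC (mem_of_one_le_eta hC (congrArg Subtype.val hone).ge)

namespace PreConeClass.IsAdaptedTo

variable {Q : PreConeClass.{u}}

theorem minimalLayer_subset (hQ : Q.IsAdaptedTo V) : MinimalLayer G V ⊆ Q G := fun C hC => by
  obtain ⟨D, hDQ, hDC⟩ := hQ.exists_mem_le hC.prop
  rwa [← hC.eq_of_le (hQ.subset_vPreCones hDQ) hDC]

theorem one_le_eta_of_mem_minimalLayer (hQ : Q.IsAdaptedTo V) {C : PreCone G}
    (hC : C ∈ MinimalLayer G V) {a : G} (ha : a ∈ C) (ha' : a⁻¹ ∈ C) :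
    1 ≤ FreeLGroup.eta V G a :=
  hQ.one_le_eta_of_forall_mem fun D hD =>
    have hlex : C.lex D ∈ Q G := hQ.lex_mem (hQ.minimalLayer_subset hC) hD
    (hC.le_of_le (hQ.subset_vPreCones hlex) (C.lex_le D) ha).2 ha'

theorem isRightOrder_of_etaComap_mem_minimalLayer (hQ : Q.IsAdaptedTo V)
    {D : PreCone (FreeLGroup.EtaImage V G)} (hD : etaComap D ∈ MinimalLayer G V) :
    D.IsRightOrder := by
  refine etaRange_surjective.forall.2 fun a ha ha' => ?_
  rw [← map_inv] at ha'
  have hle : 1 ≤ FreeLGroup.eta V G a := hQ.one_le_eta_of_mem_minimalLayer hD ha ha'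
  have hge : 1 ≤ FreeLGroup.eta V G a⁻¹ :=
    hQ.one_le_eta_of_mem_minimalLayer hD ha' (by rwa [inv_inv])
  rw [map_inv, one_le_inv'] at hge
  exact Subtype.ext (le_antisymm hge hle)

theorem image_etaComap_eq_minimalLayer (hQ : Q.IsAdaptedTo V) :
    etaComap '' {D | D.IsRightOrder ∧ D ∈ Q (FreeLGroup.EtaImage V G)} = MinimalLayer G V := by
  refine Set.Subset.antisymm ?_ fun C hC => ?_
  · rintro _ ⟨D, ⟨hD, hDQ⟩, rfl⟩
    exact ⟨hQ.subset_vPreCones (hQ.comap_mem hDQ), fun C hC => hD.le_of_le_etaComap hC⟩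
  · obtain ⟨D, rfl⟩ := PreCone.exists_etaComap_eq hC.prop
    exact ⟨D, ⟨hQ.isRightOrder_of_etaComap_mem_minimalLayer hC,
      hQ.of_comap_mem etaRange_surjective (hQ.minimalLayer_subset hC)⟩, rfl⟩

/-- The homeomorphism of the minimal layer with the right orders on `η[G]` in a class of pre-cones
adapted to `V`; its inverse sends a right order to its preimage under `η`. -/
noncomputable def minimalLayerHomeomorph (hQ : Q.IsAdaptedTo V) :
    MinimalLayer G V ≃ₜ
      {D : PreCone (FreeLGroup.EtaImage V G) | D.IsRightOrder ∧ D ∈ Q (FreeLGroup.EtaImage V G)} :=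
  (((PreCone.isEmbedding_comap _ etaRange_monotone etaRange_surjective).homeomorphImage _).trans
    (Homeomorph.setCongr hQ.image_etaComap_eq_minimalLayer)).symm

end PreConeClass.IsAdaptedTo

end MinimalLayer

theorem biOrders_eq_of_commute {G : Type*} [Group G] [PartialOrder G]
    (hG : ∀ a b : G, a * b = b * a) :
    BiOrders G = {C : PreCone G | C.IsRightOrder ∧ C.ContainsCommutators} :=
  Set.ext fun C => and_congr_right fun _ =>
    ⟨fun _ => C.containsCommutators_of_commute hG, fun hC => hC.isNormal⟩

theorem etaImage_mul_comm {G : Type u} [Group G] [PartialOrder G]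
    (a b : FreeLGroup.EtaImage AbelianLGroups G) : a * b = b * a :=
  Subtype.ext (FreeLGroup.mem_abelian a.1 b.1)

end RightPreorders

theorem theorem5p10 (G : Type u) [Group G] [PartialOrder G] [MulLeftMono G] [MulRightMono G] :
    Nonempty (MinimalLayer G AllLGroups ≃ₜ
      RightOrders (FreeLGroup.EtaImage AllLGroups G)) ∧
    Nonempty (MinimalLayer G RepresentableLGroups ≃ₜ
      BiOrders (FreeLGroup.EtaImage RepresentableLGroups G)) ∧
    Nonempty (MinimalLayer G AbelianLGroups ≃ₜ
      BiOrders (FreeLGroup.EtaImage AbelianLGroups G)) := by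
  refine ⟨⟨?all⟩, ⟨?representable⟩, ⟨?abelian⟩⟩
  case all =>
    exact PreConeClass.univ_isAdaptedTo_allLGroups.minimalLayerHomeomorph.trans
      (.setCongr (Set.ext fun _ => and_iff_left trivial))
  case representable =>
    exact PreConeClass.isNormal_isAdaptedTo_representableLGroups.minimalLayerHomeomorph
  case abelian =>
    exact PreConeClass.containsCommutators_isAdaptedTo_abelianLGroups.minimalLayerHomeomorph.trans
      (.setCongr (biOrders_eq_of_commute etaImage_mul_comm).symm)
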